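/- Let $\mathcal B$ be a connected building set on $[n]$: a collection of nonempty subsets of $[n]$ that contains all singletons and $[n]$ itself, and contains $I\cup J$ whenever $I,J\in\mathcal B$ and $I\cap J\neq\emptyset$. Let $P_{\mathcal B}=\sum_{I\in\mathcal B}y_I\Delta_I\subset\mathbb R^n$ (Minkowski sum) be its nestohedron, where the $y_I>0$ are arbitrary and $\Delta_I=\mathrm{conv}\{e_i: i\in I\}$. For a full-dimensional cone $\sigma$ of the normal fan $\mathcal N(P_{\mathcal B})$ (the normal cone of a face $F$ consists of the linear functionals $x=(x_1,\dots,x_n)$ that attain their maximum over $P_{\mathcal B}$ at every point of $F$), let $Q_\sigma$ be the poset on $[n]$ with $i\le_{Q_\sigma}j$ if and only if $x_i\le x_j$ for all $x\in\sigma$. For a poset $Q$ on $[n]$ put $\mathrm{Des}(Q)=\{(i,j): i\lessdot_Q j,\ i>j\}$, where $\lessdot_Q$ is the covering relation, $\mathrm{des}(Q)=|\mathrm{Des}(Q)|$ and $\mathrm{maj}(Q)=\sum_{(i,j)\in\mathrm{Des}(Q)}\rho(j)$, where $\rho:Q\to\mathbb Z_{\ge0}$ is the minimal rank function of $Q$: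 $\rho(y)=\rho(x)+1$ whenever $x\lessdot_Q y$, and $\rho-1$ is not a nonnegative function with this property. The $q$-$h$-polynomial of $P_{\mathcal B}$ is $$h_{\mathcal B}(t,q)=\sum_{\sigma}t^{\mathrm{des}(Q_\sigma)}q^{\mathrm{maj}(Q_\sigma)},$$ summed over the full-dimensional cones $\sigma$ of $\mathcal N(P_{\mathcal B})$. A $\mathcal B$-tree is a rooted tree $T$ on the vertex set $[n]$ such that, with $T_{\le i}$ the set of descendants of $i$ (including $i$), one has $T_{\le i}\in\mathcal B$ for all $i\in[n]$, and $\bigcup_{j=1}^kT_{\le i_j}\notin\mathcal B$ for any $k\ge2$ distinct nodes $i_1,\dots,i_k$ none of which is a descendant of another. Write $i\lessdot_Tj$ if $\{i,j\}$ is an edge of $T$ and $j$ is the endpoint closer to the root, let $\mathrm{dp}(x)$ be the length of the path from $x$ to the root, and put $\mathrm{depth}(T)=\max_x\mathrm{dp}(x)$, $\mathrm{Des}(T)=\{(i,j): i\lessdot_Tj,\ i>j\}$, $\mathrm{des}(T)=|\mathrm{Des}(T)|$ and $$\mathrm{maj}(T)=\sum_{(i,j)\in\mathrm{Des}(T)}\bigl(\mathrm{depth}(T)-\mathrm{dp}(j)\bigr).$$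 Then $h_{\mathcal B}(t,q)$ is well defined (there are finitely many full-dimensional cones $\sigma$ in $\mathcal N(P_{\mathcal B})$, and each $Q_\sigma$ has exactly one minimal rank function), and $$h_{\mathcal B}(t,q)=\sum_{T}t^{\mathrm{des}(T)}q^{\mathrm{maj}(T)},$$ where the sum is over all $\mathcal B$-trees $T$. -/

import Mathlib

open scoped Pointwise

noncomputable section

namespace QH

variable {n : ℕ}

/-! ### Posets on `[n]` (modelled as `Fin n` with its usual order as order of the labels) -/

/-- The covering relation `i ⋖_Q j`. -/
def Covers (Q : PartialOrder (Fin n)) (i j : Fin n) : Prop :=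
  @CovBy (Fin n) Q.toLT i j

open Classical in
/-- The descent set: pairs `(i, j)` with `i ⋖_Q j` and `i > j` as numbers. -/
def posetDescents (Q : PartialOrder (Fin n)) : Finset (Fin n × Fin n) :=
  Finset.univ.filter fun p => Covers Q p.1 p.2 ∧ p.2.val < p.1.val

/-- The descent number of a poset. -/
def posetDes (Q : PartialOrder (Fin n)) : ℕ := (posetDescents Q).card

/-- A rank function raises by exactly one along every covering relation. -/
def IsRankFunction (Q : PartialOrder (Fin n)) (ρ : Fin n → ℕ) : Prop :=
  ∀ x y, Covers Q x y → ρ y = ρ x + 1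

/-- A rank function `ρ` is minimal if `ρ - 1` is not a (nonnegative) rank function. -/
def IsMinimalRankFunction (Q : PartialOrder (Fin n)) (ρ : Fin n → ℕ) : Prop :=
  IsRankFunction Q ρ ∧ ¬ ∃ ρ' : Fin n → ℕ, IsRankFunction Q ρ' ∧ ∀ x, ρ x = ρ' x + 1

/-- The minimal rank function of a poset that has exactly one
(an unspecified function for other posets). -/
def minimalRank (Q : PartialOrder (Fin n)) : Fin n → ℕ :=
  Classical.epsilon (IsMinimalRankFunction Q)

/-- The major index: the sum of `ρ j` over the descents `(i, j)`. -/
def posetMaj (Q : PartialOrder (Fin n)) : ℕ :=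
  ∑ p ∈ posetDescents Q, minimalRank Q p.2

/-! ### Normal fans

Linear functionals on `ℝⁿ` are written by their coordinates: `ℓ` acts by `x ↦ ℓ ⬝ᵥ x`. -/

/-- `F` is a face of `P`: the set of points of `P` at which some functional is maximal on `P`. -/
def IsFace (P F : Set (Fin n → ℝ)) : Prop :=
  ∃ l : Fin n → ℝ, F = {x | x ∈ P ∧ ∀ y ∈ P, l ⬝ᵥ y ≤ l ⬝ᵥ x}

/-- The normal cone of `F` in `P`: functionals that attain their maximum on `P` at every
point of `F`. -/
def normalCone (P F : Set (Fin n → ℝ)) : Set (Fin n → ℝ) :=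
  {l | ∀ x ∈ F, ∀ y ∈ P, l ⬝ᵥ y ≤ l ⬝ᵥ x}

/-- The normal fan: the set of the normal cones of all faces. -/
def normalFan (P : Set (Fin n → ℝ)) : Set (Set (Fin n → ℝ)) :=
  {σ | ∃ F, IsFace P F ∧ σ = normalCone P F}

/-- A cone is full-dimensional if the smallest affine subspace that contains it is everything. -/
def IsFullDim (σ : Set (Fin n → ℝ)) : Prop := affineSpan ℝ σ = ⊤

/-- The full-dimensional cones of the normal fan. -/
def maxCones (P : Set (Fin n → ℝ)) : Set (Set (Fin n → ℝ)) :=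
  {σ | σ ∈ normalFan P ∧ IsFullDim σ}

theorem IsFullDim.eq_of_forall {σ : Set (Fin n → ℝ)} (hσ : IsFullDim σ) {i j : Fin n}
    (h : ∀ x ∈ σ, x i = x j) : i = j := by
  by_contra hij
  have h1 : affineSpan ℝ σ ≤
      (LinearMap.ker (LinearMap.proj (R := ℝ) (φ := fun _ : Fin n => ℝ) i
        - LinearMap.proj j)).toAffineSubspace := by
    rw [affineSpan_le]
    intro x hx
    simp [h x hx]
  rw [hσ] at h1
  have h2 := h1 (AffineSubspace.mem_top ℝ (Fin n → ℝ) (Pi.single i (1 : ℝ)))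
  simp [Ne.symm hij] at h2

/-- The poset `Q_σ` of a full-dimensional cone: `i ≤ j` iff `x_i ≤ x_j` for all `x ∈ σ`. -/
@[reducible]
def conePoset (σ : Set (Fin n → ℝ)) (hσ : IsFullDim σ) : PartialOrder (Fin n) where
  le i j := ∀ x ∈ σ, x i ≤ x j
  lt i j := (∀ x ∈ σ, x i ≤ x j) ∧ ¬ ∀ x ∈ σ, x j ≤ x i
  lt_iff_le_not_ge _ _ := Iff.rfl
  le_refl _ _ _ := le_rfl
  le_trans _ _ _ h₁ h₂ x hx := (h₁ x hx).trans (h₂ x hx)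
  le_antisymm _ _ h₁ h₂ := hσ.eq_of_forall fun x hx => le_antisymm (h₁ x hx) (h₂ x hx)

/-- The `q`-`h`-polynomial: the sum of `t ^ des(Q_σ) * q ^ maj(Q_σ)` over the full-dimensional
cones `σ` of the normal fan, where `t` is the variable `X 0` and `q` is the variable `X 1`. -/
def qhPolynomial (P : Set (Fin n → ℝ)) : MvPolynomial (Fin 2) ℤ :=
  ∑ᶠ σ : maxCones P,
    MvPolynomial.X 0 ^ posetDes (conePoset σ.1 σ.2.2) *
      MvPolynomial.X 1 ^ posetMaj (conePoset σ.1 σ.2.2)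

/-! ### Building sets and nestohedra -/

/-- Building sets on `[n]`. -/
structure IsBuildingSet (B : Finset (Finset (Fin n))) : Prop where
  nonempty : ∀ I ∈ B, I.Nonempty
  union_mem : ∀ I ∈ B, ∀ J ∈ B, (I ∩ J).Nonempty → I ∪ J ∈ B
  singleton_mem : ∀ i, {i} ∈ B

/-- A building set is connected if it contains `[n]`. -/
def IsConnectedBuildingSet (B : Finset (Finset (Fin n))) : Prop :=
  IsBuildingSet B ∧ Finset.univ ∈ B

/-- The simplex `Δ_I`, the convex hull of the standard basis vectors `e_i`, `i ∈ I`. -/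
def simplex (I : Finset (Fin n)) : Set (Fin n → ℝ) :=
  convexHull ℝ ((fun i => Pi.single i (1 : ℝ)) '' (I : Set (Fin n)))

/-- The Minkowski sum of the dilated simplices `y_I Δ_I`, `I ∈ B`. -/
def nestohedron (B : Finset (Finset (Fin n))) (y : Finset (Fin n) → ℝ) : Set (Fin n → ℝ) :=
  ∑ I ∈ B, y I • simplex I

/-! ### Rooted trees and `B`-trees -/

/-- A rooted tree with vertex set `[n]`. -/
@[ext]
structure LabelledTree (n : ℕ) where
  graph : SimpleGraph (Fin n)
  root : Fin n
  isTree : graph.IsTree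

instance : Finite (LabelledTree n) :=
  Finite.of_injective (fun T : LabelledTree n => (T.graph, T.root)) fun _ _ h =>
    LabelledTree.ext (congrArg Prod.fst h) (congrArg Prod.snd h)

instance : Fintype (LabelledTree n) := Fintype.ofFinite _

namespace LabelledTree

/-- The length of the path from `x` to the root. -/
def dp (T : LabelledTree n) (x : Fin n) : ℕ := T.graph.dist x T.root

/-- The depth of the tree, the largest depth of a node. -/
def depth (T : LabelledTree n) : ℕ := Finset.univ.sup T.dp

/-- `i ⋖_T j`: there is an edge between `i` and `j`, and `j` is closer to the root. -/
def Edge (T : LabelledTree n) (i j : Fin n) : Prop := T.graph.Adj i j ∧ T.dp j < T.dp i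

/-- `i ≤_T j`: the directed path from `j` away from the root reaches `i`. -/
def Le (T : LabelledTree n) (i j : Fin n) : Prop := Relation.ReflTransGen T.Edge i j

open Classical in
/-- `T_{≤ i}`: the set of descendants of `i`, including `i`. -/
def descendants (T : LabelledTree n) (i : Fin n) : Finset (Fin n) :=
  Finset.univ.filter fun j => T.Le j i

open Classical in
/-- The descent set: pairs `(i, j)` with `i ⋖_T j` and `i > j` as numbers. -/
def descents (T : LabelledTree n) : Finset (Fin n × Fin n) :=
  Finset.univ.filter fun p => T.Edge p.1 p.2 ∧ p.2.val < p.1.val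

/-- The descent number of a rooted tree. -/
def des (T : LabelledTree n) : ℕ := T.descents.card

/-- The major index of a rooted tree (`dp j ≤ depth`, so the subtraction never truncates). -/
def maj (T : LabelledTree n) : ℕ := ∑ p ∈ T.descents, (T.depth - T.dp p.2)

/-- `T` is a `B`-tree: all descendant sets lie in `B`, and the union of the descendant sets of
two or more pairwise incomparable nodes never does. -/
structure IsBTree (B : Finset (Finset (Fin n))) (T : LabelledTree n) : Prop where
  descendants_mem : ∀ i, T.descendants i ∈ B
  union_notMem : ∀ S : Finset (Fin n), 2 ≤ S.card →
    (∀ i ∈ S, ∀ j ∈ S, i ≠ j → ¬ T.Le i j) → S.biUnion T.descendants ∉ B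

end LabelledTree

end QH

end

open scoped Pointwise

namespace QH

variable {n : ℕ}

namespace LabelledTree

variable (T : LabelledTree n)

/-! ### The order of a rooted tree -/

/-! Sending a `B`-tree `T` to `T.cone` is a bijection onto the full-dimensional normal cones, and
the poset of `T.cone` is the order of `T` (`forall_mem_cone_le_iff`). Its covers are the edges of
`T` and its minimal rank function is `depth - dp`, so the two sums agree term by term.

A functional `x` with distinct coordinates is maximal only at the vertex `∑ y_I e_{m(I)}`, where
`m(I)` is the argmax of `x` on `I`. As all `y_I` are positive, the normal cone there is cut out by
`x_i ≤ x_{m(I)}` for `i ∈ I ∈ B` (`normalCone_vertex`). In a `B`-tree every `I ∈ B` has a top node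
(`IsBTree.exists_top`), and with `m(I)` this node the inequalities describe `T.cone` (`cone_eq`).
Conversely, a full-dimensional cone contains such an `x`, and the sets `maxBlock B x j` are the
descendant sets of a `B`-tree with that cone (`exists_cone_eq`). -/

theorem dp_root : T.dp T.root = 0 := by simp [dp]

theorem dp_le_depth (i : Fin n) : T.dp i ≤ T.depth :=
  Finset.le_sup (f := T.dp) (Finset.mem_univ i)

variable {T}

theorem dp_eq_of_adj {i j : Fin n} (h : T.graph.Adj i j) :
    T.dp i = T.dp j + 1 ∨ T.dp j = T.dp i + 1 := by
  have := T.isTree.dist_eq_dist_add_one_of_adj T.root h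
  rwa [SimpleGraph.dist_comm (v := i), SimpleGraph.dist_comm (v := j)] at this

theorem Edge.dp_eq {i j : Fin n} (h : T.Edge i j) : T.dp i = T.dp j + 1 := by
  have := dp_eq_of_adj h.1
  have := h.2
  omega

theorem adj_iff {i j : Fin n} : T.graph.Adj i j ↔ T.Edge i j ∨ T.Edge j i := by
  refine ⟨fun h => ?_, fun h => h.elim (fun h => h.1) fun h => h.1.symm⟩
  rcases dp_eq_of_adj h with h' | h'
  · exact .inl ⟨h, by omega⟩
  · exact .inr ⟨h.symm, by omega⟩

theorem exists_edge {i : Fin n} (hi : i ≠ T.root) : ∃ j, T.Edge i j := by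
  obtain ⟨p, hp⟩ := (T.isTree.connected i T.root).exists_walk_length_eq_dist
  cases p with
  | nil => exact absurd rfl hi
  | @cons _ j _ h p =>
    refine ⟨j, h, ?_⟩
    have := SimpleGraph.dist_le p
    simp only [SimpleGraph.Walk.length_cons] at hp
    simp only [dp]
    omega

/-- Two parents would start two geodesics to the root, but paths in a tree are unique. -/
theorem Edge.unique {i j k : Fin n} (hj : T.Edge i j) (hk : T.Edge i k) : j = k := by
  obtain ⟨p, hp⟩ := (T.isTree.connected j T.root).exists_walk_length_eq_dist
  obtain ⟨q, hq⟩ := (T.isTree.connected k T.root).exists_walk_length_eq_dist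
  have hp' : (SimpleGraph.Walk.cons hj.1 p).IsPath := by
    apply SimpleGraph.Walk.isPath_of_length_eq_dist
    rw [SimpleGraph.Walk.length_cons, hp]
    exact hj.dp_eq.symm
  have hq' : (SimpleGraph.Walk.cons hk.1 q).IsPath := by
    apply SimpleGraph.Walk.isPath_of_length_eq_dist
    rw [SimpleGraph.Walk.length_cons, hq]
    exact hk.dp_eq.symm
  have := (T.isTree.existsUnique_path i T.root).unique hp' hq'
  simpa using congrArg SimpleGraph.Walk.snd this

theorem not_edge_root (j : Fin n) : ¬ T.Edge T.root j := fun h => by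
  have := h.2
  simp [dp_root] at this

theorem Le.refl (i : Fin n) : T.Le i i := Relation.ReflTransGen.refl

theorem Le.trans {i j k : Fin n} (h : T.Le i j) (h' : T.Le j k) : T.Le i k :=
  Relation.ReflTransGen.trans h h'

theorem Edge.le {i j : Fin n} (h : T.Edge i j) : T.Le i j := Relation.ReflTransGen.single h

theorem Le.dp_le {i j : Fin n} (h : T.Le i j) : T.dp j ≤ T.dp i := by
  induction h with
  | refl => rfl
  | tail _ h ih => exact h.2.le.trans ih

theorem Le.dp_lt {i j : Fin n} (h : T.Le i j) (hij : i ≠ j) : T.dp j < T.dp i := by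
  rcases Relation.ReflTransGen.cases_head h with h | ⟨k, hk, hkj⟩
  · exact absurd h hij
  · exact (Le.dp_le hkj).trans_lt hk.2

theorem Le.antisymm {i j : Fin n} (h : T.Le i j) (h' : T.Le j i) : i = j := by
  by_contra hij
  exact absurd (h.dp_lt hij) h'.dp_le.not_gt

theorem le_root (i : Fin n) : T.Le i T.root := by
  induction hd : T.dp i using Nat.strong_induction_on generalizing i with
  | _ d ih =>
    by_cases hi : i = T.root
    · exact hi ▸ Le.refl _
    · obtain ⟨j, hj⟩ := exists_edge hi
      exact hj.le.trans (ih _ (hd ▸ hj.2) j rfl)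

theorem mem_descendants {i j : Fin n} : j ∈ T.descendants i ↔ T.Le j i := by
  simp [descendants]

/-- Expresses edges through the order alone, so that the order determines the tree and edges can be
compared with poset covers. -/
theorem edge_iff {i j : Fin n} :
    T.Edge i j ↔ (T.Le i j ∧ i ≠ j) ∧ ∀ k, T.Le i k → T.Le k j → k = i ∨ k = j := by
  constructor
  · intro h
    refine ⟨⟨h.le, ?_⟩, fun k hik hkj => ?_⟩
    · rintro rfl
      exact absurd h.2 (lt_irrefl _)
    · by_contra! hk
      have h₁ := hik.dp_lt hk.1.symm
      have h₂ := hkj.dp_lt hk.2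
      have := h.dp_eq
      omega
  · rintro ⟨⟨h, hij⟩, hk⟩
    rcases Relation.ReflTransGen.cases_head h with h | ⟨k, hik, hkj⟩
    · exact absurd h hij
    · rcases hk k hik.le hkj with rfl | rfl
      · exact absurd hik.2 (lt_irrefl _)
      · exact hik

theorem ext_le {T' : LabelledTree n} (h : ∀ i j, T.Le i j ↔ T'.Le i j) : T = T' := by
  ext i j
  · simp only [adj_iff, edge_iff, h]
  · rw [((h _ _).1 (le_root T'.root)).antisymm (le_root T.root)]

/-! ### Posets that are the order of a rooted tree -/

theorem covers_iff {Q : PartialOrder (Fin n)} (hQ : ∀ i j, Q.le i j ↔ T.Le i j) {i j : Fin n} :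
    Covers Q i j ↔ T.Edge i j := by
  have hlt : ∀ a b, Q.lt a b ↔ T.Le a b ∧ a ≠ b := fun a b => by
    rw [← hQ]
    exact @lt_iff_le_and_ne _ Q a b
  rw [edge_iff]
  unfold Covers CovBy
  refine and_congr (hlt i j) ⟨fun h k hik hkj => ?_, fun h k hik hkj => ?_⟩
  · by_contra! hk
    exact h ((hlt _ _).2 ⟨hik, hk.1.symm⟩) ((hlt _ _).2 ⟨hkj, hk.2⟩)
  · have h₁ := (hlt _ _).1 hik
    have h₂ := (hlt _ _).1 hkj
    rcases h k h₁.1 h₂.1 with rfl | rfl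
    · exact h₁.2 rfl
    · exact h₂.2 rfl

variable {Q : PartialOrder (Fin n)} (hQ : ∀ i j, Q.le i j ↔ T.Le i j)
include hQ

theorem isRankFunction_iff {ρ : Fin n → ℕ} :
    IsRankFunction Q ρ ↔ ∀ i, ρ i + T.dp i = ρ T.root := by
  simp only [IsRankFunction, covers_iff hQ]
  constructor
  · intro h i
    have hi := le_root (T := T) i
    induction hi using Relation.ReflTransGen.head_induction_on with
    | refl => simp [dp_root]
    | head hab _ ih =>
      have := h _ _ hab
      have := hab.dp_eq
      omega
  · intro h i j hij
    have := hij.dp_eq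
    have := h i
    have := h j
    omega

/-- For a rank function `ρ + dp` is constant, so `ρ` is least at a deepest node `b`; minimality
means that `ρ b = 0`. -/
theorem isMinimalRankFunction_iff {ρ : Fin n → ℕ} :
    IsMinimalRankFunction Q ρ ↔ ρ = fun i => T.depth - T.dp i := by
  have hne : (Finset.univ : Finset (Fin n)).Nonempty := ⟨T.root, Finset.mem_univ _⟩
  obtain ⟨b, -, hb⟩ := Finset.exists_mem_eq_sup _ hne T.dp
  replace hb : T.depth = T.dp b := hb
  have h0 := T.dp_root
  constructor
  · rintro ⟨h, hmin⟩
    rw [isRankFunction_iff hQ] at h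
    have hroot : ρ T.root = T.depth := by
      by_contra hr
      refine hmin ⟨fun i => ρ i - 1, (isRankFunction_iff hQ).2 fun i => ?_, fun i => ?_⟩
      all_goals
        have := h i
        have := h b
        have := T.dp_le_depth i
        beta_reduce
        omega
    funext i
    have := h i
    omega
  · rintro rfl
    refine ⟨(isRankFunction_iff hQ).2 fun i => ?_, ?_⟩
    · have := T.dp_le_depth i
      omega
    · rintro ⟨ρ', -, h⟩
      have := h b
      dsimp only at this
      omega

theorem existsUnique_isMinimalRankFunction : ∃! ρ, IsMinimalRankFunction Q ρ := by
  simp only [isMinimalRankFunction_iff hQ]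
  exact existsUnique_eq

theorem minimalRank_eq : minimalRank Q = fun i => T.depth - T.dp i :=
  (isMinimalRankFunction_iff hQ).1
    (Classical.epsilon_spec (existsUnique_isMinimalRankFunction hQ).exists)

theorem posetDescents_eq : posetDescents Q = T.descents := by
  ext p
  simp [posetDescents, descents, covers_iff hQ]

theorem posetDes_eq : posetDes Q = T.des := by
  rw [posetDes, posetDescents_eq hQ, des]

theorem posetMaj_eq : posetMaj Q = T.maj := by
  rw [posetMaj, posetDescents_eq hQ, minimalRank_eq hQ, maj]

end LabelledTree
end QH

namespace QH

variable {n : ℕ}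

/-! ### Faces and normal cones of nestohedra -/

theorem mem_simplex_le {I : Finset (Fin n)} {s : Fin n → ℝ} (hs : s ∈ simplex I)
    {l : Fin n → ℝ} {c : ℝ} (h : ∀ i ∈ I, l i ≤ c) : l ⬝ᵥ s ≤ c := by
  have hc : Convex ℝ {s : Fin n → ℝ | l ⬝ᵥ s ≤ c} :=
    convex_halfSpace_le (f := fun s => l ⬝ᵥ s)
      ⟨fun a b => dotProduct_add l a b, fun a b => dotProduct_smul a l b⟩ c
  refine convexHull_min ?_ hc hs
  rintro _ ⟨i, hi, rfl⟩
  simpa using h i hi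

theorem eq_single_of_mem_simplex {I : Finset (Fin n)} {s : Fin n → ℝ} (hs : s ∈ simplex I)
    {l : Fin n → ℝ} {m : Fin n} (h : ∀ i ∈ I, i ≠ m → l i < l m) (hl : l m ≤ l ⬝ᵥ s) :
    s = Pi.single m 1 := by
  -- The equations and inequalities for `Δ_I` come from `mem_simplex_le`, applied to coordinate and
  -- constant functionals.
  have hnonneg : ∀ i, 0 ≤ s i := fun i => by
    have := mem_simplex_le hs (l := -Pi.single i 1) (c := 0) fun j _ => by
      by_cases hij : j = i
      · subst hij; simp
      · simp [hij]
    simpa using this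
  have hsum : ∑ i, s i = 1 := by
    have h₁ := mem_simplex_le hs (l := fun _ => 1) (c := 1) fun _ _ => le_rfl
    have h₂ := mem_simplex_le hs (l := fun _ => -1) (c := -1) fun _ _ => le_rfl
    simp only [dotProduct, one_mul, neg_mul, Finset.sum_neg_distrib] at h₁ h₂
    linarith
  have hI : ∀ i ∉ I, s i = 0 := fun i hi => by
    have := mem_simplex_le hs (l := Pi.single i 1) (c := 0) fun j hj => by
      rw [Pi.single_eq_of_ne]
      rintro rfl
      exact hi hj
    refine le_antisymm (by simpa using this) (hnonneg i)
  have hterm : ∀ i ∈ Finset.univ, 0 ≤ (l m - l i) * s i := fun i _ => by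
    by_cases hi : i ∈ I
    · by_cases him : i = m
      · simp [him]
      · exact mul_nonneg (sub_nonneg.2 (h i hi him).le) (hnonneg i)
    · simp [hI i hi]
  -- A sum of nonnegative terms that is at most zero: every coordinate other than `m` must vanish.
  have hzero : ∑ i, (l m - l i) * s i = 0 := by
    refine le_antisymm ?_ (Finset.sum_nonneg hterm)
    simp only [sub_mul, Finset.sum_sub_distrib, ← Finset.mul_sum, hsum]
    simp only [dotProduct] at hl
    linarith
  have hne : ∀ i, i ≠ m → s i = 0 := fun i him => by
    by_cases hi : i ∈ I
    · have := (Finset.sum_eq_zero_iff_of_nonneg hterm).1 hzero i (Finset.mem_univ i)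
      exact (mul_eq_zero.1 this).resolve_left (sub_pos.2 (h i hi him)).ne'
    · exact hI i hi
  funext i
  by_cases him : i = m
  · subst him
    rw [Finset.sum_eq_single i (fun j _ hj => hne j hj) (by simp)] at hsum
    simpa using hsum
  · rw [hne i him, Pi.single_eq_of_ne him]

variable {B : Finset (Finset (Fin n))} {y : Finset (Fin n) → ℝ}

theorem mem_nestohedron {x : Fin n → ℝ} :
    x ∈ nestohedron B y ↔ ∃ s : Finset (Fin n) → Fin n → ℝ,
      (∀ I ∈ B, s I ∈ simplex I) ∧ ∑ I ∈ B, y I • s I = x := by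
  rw [nestohedron, Set.mem_finsetSum]
  constructor
  · rintro ⟨g, hg, rfl⟩
    have : ∀ I, ∃ s, I ∈ B → s ∈ simplex I ∧ y I • s = g I := fun I => by
      by_cases hI : I ∈ B
      · obtain ⟨s, hs⟩ := Set.mem_smul_set.1 (hg hI)
        exact ⟨s, fun _ => hs⟩
      · exact ⟨0, fun h => absurd h hI⟩
    choose s hs using this
    exact ⟨s, fun I hI => (hs I hI).1, Finset.sum_congr rfl fun I hI => (hs I hI).2⟩
  · rintro ⟨s, hs, rfl⟩
    exact ⟨fun I => y I • s I, fun hI => Set.smul_mem_smul_set (hs _ hI), rfl⟩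

/-- The sum of the vertices `y_I e_{m(I)}` of the summands `y_I Δ_I`. -/
noncomputable def vertex (B : Finset (Finset (Fin n))) (y : Finset (Fin n) → ℝ)
    (m : Finset (Fin n) → Fin n) : Fin n → ℝ :=
  ∑ I ∈ B, y I • Pi.single (m I) (1 : ℝ)

theorem single_mem_simplex {I : Finset (Fin n)} {i : Fin n} (hi : i ∈ I) :
    Pi.single i (1 : ℝ) ∈ simplex I :=
  subset_convexHull _ _ ⟨i, hi, rfl⟩

theorem vertex_mem {m : Finset (Fin n) → Fin n} (hm : ∀ I ∈ B, m I ∈ I) :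
    vertex B y m ∈ nestohedron B y :=
  mem_nestohedron.2 ⟨_, fun I hI => single_mem_simplex (hm I hI), rfl⟩

theorem dotProduct_vertex (l : Fin n → ℝ) (m : Finset (Fin n) → Fin n) :
    l ⬝ᵥ vertex B y m = ∑ I ∈ B, y I * l (m I) := by
  simp [vertex, dotProduct_sum]

variable (hy : ∀ I ∈ B, 0 < y I)
include hy

theorem dotProduct_le_vertex {l : Fin n → ℝ} {m : Finset (Fin n) → Fin n}
    (hm : ∀ I ∈ B, ∀ i ∈ I, l i ≤ l (m I)) {x : Fin n → ℝ} (hx : x ∈ nestohedron B y) :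
    l ⬝ᵥ x ≤ l ⬝ᵥ vertex B y m := by
  obtain ⟨s, hs, rfl⟩ := mem_nestohedron.1 hx
  rw [dotProduct_vertex, dotProduct_sum]
  refine Finset.sum_le_sum fun I hI => ?_
  rw [dotProduct_smul, smul_eq_mul]
  exact mul_le_mul_of_nonneg_left (mem_simplex_le (hs I hI) (hm I hI)) (hy I hI).le

theorem eq_vertex_of_dotProduct_le {l : Fin n → ℝ} {m : Finset (Fin n) → Fin n}
    (hm : ∀ I ∈ B, ∀ i ∈ I, i ≠ m I → l i < l (m I)) {x : Fin n → ℝ}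
    (hx : x ∈ nestohedron B y) (hl : l ⬝ᵥ vertex B y m ≤ l ⬝ᵥ x) : x = vertex B y m := by
  obtain ⟨s, hs, rfl⟩ := mem_nestohedron.1 hx
  rw [dotProduct_vertex, dotProduct_sum] at hl
  simp only [dotProduct_smul, smul_eq_mul] at hl
  have hle : ∀ I ∈ B, y I * (l ⬝ᵥ s I) ≤ y I * l (m I) := fun I hI =>
    mul_le_mul_of_nonneg_left (mem_simplex_le (hs I hI) fun i hi => by
      by_cases him : i = m I
      · rw [him]
      · exact (hm I hI i hi him).le) (hy I hI).le
  have heq := (Finset.sum_eq_sum_iff_of_le hle).1 (le_antisymm (Finset.sum_le_sum hle) hl)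
  refine Finset.sum_congr rfl fun I hI => ?_
  rw [eq_single_of_mem_simplex (hs I hI) (hm I hI)
    (mul_left_cancel₀ (hy I hI).ne' (heq I hI)).ge]

theorem isFace_vertex {l : Fin n → ℝ} {m : Finset (Fin n) → Fin n} (hmem : ∀ I ∈ B, m I ∈ I)
    (hm : ∀ I ∈ B, ∀ i ∈ I, i ≠ m I → l i < l (m I)) :
    IsFace (nestohedron B y) {vertex B y m} := by
  refine ⟨l, Set.ext fun x => ⟨?_, fun hx => ?_⟩⟩
  · rintro rfl
    refine ⟨vertex_mem hmem, fun z hz => dotProduct_le_vertex hy (fun I hI i hi => ?_) hz⟩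
    by_cases him : i = m I
    · rw [him]
    · exact (hm I hI i hi him).le
  · exact eq_vertex_of_dotProduct_le hy hm hx.1 (hx.2 _ (vertex_mem hmem))

/-- To recover the inequality for `i ∈ I`, compare with the vertex sum in which only the choice for
`I` is changed, to `i`. -/
theorem normalCone_vertex {m : Finset (Fin n) → Fin n} (hmem : ∀ I ∈ B, m I ∈ I) :
    normalCone (nestohedron B y) {vertex B y m} = {x | ∀ I ∈ B, ∀ i ∈ I, x i ≤ x (m I)} := by
  ext x
  simp only [normalCone, Set.mem_singleton_iff, forall_eq, Set.mem_ofPred_eq]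
  refine ⟨fun h I hI i hi => ?_, fun h z hz => dotProduct_le_vertex hy h hz⟩
  by_contra! hlt
  have hmem' : ∀ J ∈ B, Function.update m I i J ∈ J := fun J hJ => by
    by_cases hJI : J = I
    · subst hJI; simpa using hi
    · simpa [hJI] using hmem J hJ
  have := h _ (vertex_mem (y := y) hmem')
  rw [dotProduct_vertex, dotProduct_vertex] at this
  refine this.not_gt (Finset.sum_lt_sum (fun J hJ => ?_) ⟨I, hI, ?_⟩)
  · by_cases hJI : J = I
    · subst hJI
      simpa using mul_le_mul_of_nonneg_left hlt.le (hy J hJ).le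
    · simp [hJI]
  · simpa using mul_lt_mul_of_pos_left hlt (hy I hI)

omit hy in
theorem exists_argmax [Nonempty (Fin n)] (hB : ∀ I ∈ B, I.Nonempty) (l : Fin n → ℝ) :
    ∃ m : Finset (Fin n) → Fin n, (∀ I ∈ B, m I ∈ I) ∧ ∀ I ∈ B, ∀ i ∈ I, l i ≤ l (m I) := by
  have : ∀ I, ∃ m, I ∈ B → m ∈ I ∧ ∀ i ∈ I, l i ≤ l m := fun I => by
    by_cases hI : I ∈ B
    · obtain ⟨m, hm⟩ := Finset.exists_max_image I l (hB I hI)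
      exact ⟨m, fun _ => hm⟩
    · exact ⟨Classical.arbitrary _, fun h => absurd h hI⟩
  choose m hm using this
  exact ⟨m, fun I hI => (hm I hI).1, fun I hI => (hm I hI).2⟩

theorem IsFace.nonempty [Nonempty (Fin n)] (hB : ∀ I ∈ B, I.Nonempty) {F : Set (Fin n → ℝ)}
    (hF : IsFace (nestohedron B y) F) : F.Nonempty := by
  obtain ⟨l, rfl⟩ := hF
  obtain ⟨m, hmem, hm⟩ := exists_argmax hB l
  exact ⟨_, vertex_mem hmem, fun z hz => dotProduct_le_vertex hy hm hz⟩

omit hy in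
theorem convex_normalCone (P F : Set (Fin n → ℝ)) : Convex ℝ (normalCone P F) := by
  intro a ha b hb s t hs ht _ x hx z hz
  simp only [add_dotProduct, smul_dotProduct, smul_eq_mul]
  exact add_le_add (mul_le_mul_of_nonneg_left (ha x hx z hz) hs)
    (mul_le_mul_of_nonneg_left (hb x hx z hz) ht)

omit hy in
/-- A full-dimensional convex set contains a point with distinct coordinates. -/
theorem IsFullDim.exists_injective {σ : Set (Fin n → ℝ)} (hσ : IsFullDim σ)
    (hconv : Convex ℝ σ) : ∃ x ∈ σ, Function.Injective x := by
  have hint : (interior σ).Nonempty := hconv.interior_nonempty_iff_affineSpan_eq_top.2 hσ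
  let U : {p : Fin n × Fin n // p.1 ≠ p.2} → Set (Fin n → ℝ) := fun p => {x | x p.1.1 ≠ x p.1.2}
  -- Complements of the hyperplanes `x_i = x_j` are open and dense, so their intersection is dense
  -- and meets the interior of `σ`.
  have hU : Dense (⋂ p, U p) := by
    refine dense_iInter_of_isOpen (fun p => ?_) fun p => ?_
    · exact isOpen_ne_fun (continuous_apply _) (continuous_apply _)
    · let W : Submodule ℝ (Fin n → ℝ) := LinearMap.ker
        (LinearMap.proj (R := ℝ) (φ := fun _ : Fin n => ℝ) p.1.1 - LinearMap.proj p.1.2)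
      have hUW : U p = (W : Set (Fin n → ℝ))ᶜ := by
        ext x
        simp [U, W, sub_eq_zero]
      rw [hUW, ← interior_eq_empty_iff_dense_compl, ← Set.not_nonempty_iff_eq_empty]
      intro h
      have hW := W.eq_top_of_nonempty_interior' h
      have hmem : Pi.single p.1.1 (1 : ℝ) ∈ W := hW ▸ Submodule.mem_top
      simp [W, p.2.symm] at hmem
  obtain ⟨x, hx, hxU⟩ := hU.inter_open_nonempty _ isOpen_interior hint
  refine ⟨x, interior_subset hx, fun i j hij => ?_⟩
  by_contra hne
  exact Set.mem_iInter.1 hxU ⟨(i, j), hne⟩ hij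

/-- A full-dimensional cone of the normal fan is the normal cone of the vertex at which any of
its functionals with distinct coordinates is maximal. -/
theorem maxCones_eq [Nonempty (Fin n)] (hB : ∀ I ∈ B, I.Nonempty) {σ : Set (Fin n → ℝ)}
    (hσ : σ ∈ maxCones (nestohedron B y)) :
    ∃ (x : Fin n → ℝ) (m : Finset (Fin n) → Fin n), Function.Injective x ∧
      (∀ I ∈ B, m I ∈ I ∧ ∀ i ∈ I, x i ≤ x (m I)) ∧
      σ = {x | ∀ I ∈ B, ∀ i ∈ I, x i ≤ x (m I)} := by
  obtain ⟨⟨F, hF, rfl⟩, hfull⟩ := hσ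
  obtain ⟨x, hx, hinj⟩ := hfull.exists_injective (convex_normalCone _ _)
  obtain ⟨m, hmem, hm⟩ := exists_argmax hB x
  refine ⟨x, m, hinj, fun I hI => ⟨hmem I hI, hm I hI⟩, ?_⟩
  have hFP : F ⊆ nestohedron B y := by
    obtain ⟨l, rfl⟩ := hF
    exact fun z hz => hz.1
  -- `x` is maximal at every point of `F`, yet it has a unique maximizer because its coordinates are
  -- distinct.
  have hFv : F ⊆ {vertex B y m} := fun z hz =>
    eq_vertex_of_dotProduct_le hy
      (fun I hI i hi him => (hm I hI i hi).lt_of_ne fun h => him (hinj h)) (hFP hz)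
      (hx z hz _ (vertex_mem hmem))
  rw [(Set.Nonempty.subset_singleton_iff (hF.nonempty hy hB)).1 hFv, normalCone_vertex hy hmem]

end QH

namespace QH

variable {n : ℕ}

/-! ### The cone of a `B`-tree -/

theorem IsBuildingSet.union_biUnion_mem {B : Finset (Finset (Fin n))} (hB : IsBuildingSet B)
    {ι : Type*} {J : Finset (Fin n)} (hJ : J ∈ B) (S : Finset ι) {f : ι → Finset (Fin n)}
    (hf : ∀ i ∈ S, f i ∈ B ∧ (f i ∩ J).Nonempty) : J ∪ S.biUnion f ∈ B := by
  classical
  induction S using Finset.induction_on with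
  | empty => simpa using hJ
  | insert a S _ ih =>
    have ha := hf a (Finset.mem_insert_self _ _)
    have := hB.union_mem _ ha.1 _ (ih fun i hi => hf i (Finset.mem_insert_of_mem hi))
      (ha.2.mono (Finset.inter_subset_inter_left Finset.subset_union_left))
    rwa [Finset.biUnion_insert, Finset.union_left_comm]

namespace LabelledTree

/-- The cone of the functionals that are monotone for the order of `T`. -/
def cone (T : LabelledTree n) : Set (Fin n → ℝ) :=
  {x | ∀ i j, T.Le i j → x i ≤ x j}

/-- The functionals increasing strictly along edges form an open subset of the cone, which contains
`-dp`. -/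
theorem isFullDim_cone (T : LabelledTree n) : IsFullDim T.cone := by
  have hopen : IsOpen {x : Fin n → ℝ | ∀ i j, T.Edge i j → x i < x j} := by
    simp only [Set.ofPred_forall]
    exact isOpen_iInter_of_finite fun i => isOpen_iInter_of_finite fun j =>
      isOpen_iInter_of_finite fun _ => isOpen_lt (continuous_apply i) (continuous_apply j)
  have hne : {x : Fin n → ℝ | ∀ i j, T.Edge i j → x i < x j}.Nonempty :=
    ⟨fun i => -(T.dp i : ℝ), fun i j h => by simpa using h.2⟩
  have hsub : {x : Fin n → ℝ | ∀ i j, T.Edge i j → x i < x j} ⊆ T.cone := by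
    intro x hx i j hij
    induction hij with
    | refl => rfl
    | tail _ h ih => exact ih.trans (hx _ _ h).le
  rw [IsFullDim, eq_top_iff, ← hopen.affineSpan_eq_top hne]
  exact affineSpan_mono ℝ hsub

theorem forall_mem_cone_le_iff {T : LabelledTree n} {i j : Fin n} :
    (∀ x ∈ T.cone, x i ≤ x j) ↔ T.Le i j := by
  classical
  refine ⟨fun h => ?_, fun h x hx => hx i j h⟩
  -- The indicator of the up-set of `i` is monotone and separates `i` from any node not above it.
  have := h (fun k => if T.Le i k then 1 else 0) fun a b hab => by
    by_cases ha : T.Le i a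
    · simp [ha, ha.trans hab]
    · simp only [ha, if_false]
      split_ifs <;> norm_num
  by_contra hij
  norm_num [Le.refl, hij] at this

theorem cone_injective : Function.Injective (cone (n := n)) := fun T T' h =>
  ext_le fun i j => by rw [← forall_mem_cone_le_iff, h, forall_mem_cone_le_iff]

/-- Let `S` be the set of maximal elements of `I`. The descendant sets of `S` all meet `I` and cover
it, so their union is in `B`; being pairwise incomparable, the nodes of `S` cannot number two or
more. -/
theorem IsBTree.exists_top {B : Finset (Finset (Fin n))} (hB : IsBuildingSet B)
    {T : LabelledTree n} (hT : T.IsBTree B) {I : Finset (Fin n)} (hI : I ∈ B) :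
    ∃ m ∈ I, ∀ i ∈ I, T.Le i m := by
  classical
  let S := I.filter fun s => ∀ k ∈ I, T.Le s k → k = s
  have hS : ∀ i ∈ I, ∃ s ∈ S, T.Le i s := fun i hi => by
    obtain ⟨s, hs, hmin⟩ := Finset.exists_min_image (I.filter fun k => T.Le i k) T.dp
      ⟨i, Finset.mem_filter.2 ⟨hi, Le.refl i⟩⟩
    rw [Finset.mem_filter] at hs
    refine ⟨s, Finset.mem_filter.2 ⟨hs.1, fun k hk hsk => ?_⟩, hs.2⟩
    by_contra hne
    exact (hmin k (Finset.mem_filter.2 ⟨hk, hs.2.trans hsk⟩)).not_gt (hsk.dp_lt (Ne.symm hne))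
  have hcard : S.card ≤ 1 := by
    by_contra! h2
    refine hT.union_notMem S h2 (fun i hi j hj hij h => ?_) ?_
    · exact hij ((Finset.mem_filter.1 hi).2 j (Finset.mem_filter.1 hj).1 h).symm
    · have := hB.union_biUnion_mem hI S (f := T.descendants) fun s hs =>
        ⟨hT.descendants_mem s, s, Finset.mem_inter.2
          ⟨mem_descendants.2 (Le.refl s), (Finset.mem_filter.1 hs).1⟩⟩
      rwa [Finset.union_eq_right.2] at this
      intro i hi
      obtain ⟨s, hs, his⟩ := hS i hi
      exact Finset.mem_biUnion.2 ⟨s, hs, mem_descendants.2 his⟩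
  obtain ⟨i, hi⟩ := hB.nonempty I hI
  obtain ⟨m, hm, -⟩ := hS i hi
  refine ⟨m, (Finset.mem_filter.1 hm).1, fun k hk => ?_⟩
  obtain ⟨s, hs, hks⟩ := hS k hk
  rwa [Finset.card_le_one.1 hcard m hm s hs]

/-- The cone of `T` is cut out by the inequalities between the elements of each `I ∈ B` and the
largest one of them. -/
theorem cone_eq {B : Finset (Finset (Fin n))} {T : LabelledTree n}
    (hT : ∀ i, T.descendants i ∈ B) {m : Finset (Fin n) → Fin n}
    (hm : ∀ I ∈ B, m I ∈ I ∧ ∀ i ∈ I, T.Le i (m I)) :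
    T.cone = {x | ∀ I ∈ B, ∀ i ∈ I, x i ≤ x (m I)} := by
  ext x
  refine ⟨fun h I hI i hi => h _ _ ((hm I hI).2 i hi), fun h i j hij => ?_⟩
  -- The descendant set of `j` is itself in `B`, with top `j`.
  have h₁ := hm _ (hT j)
  have h₂ : m (T.descendants j) = j :=
    (mem_descendants.1 h₁.1).antisymm (h₁.2 j (mem_descendants.2 (Le.refl j)))
  simpa [h₂] using h _ (hT j) i (mem_descendants.2 hij)

theorem IsBTree.cone_mem {B : Finset (Finset (Fin n))} (hB : IsBuildingSet B)
    {y : Finset (Fin n) → ℝ} (hy : ∀ I ∈ B, 0 < y I) {T : LabelledTree n} (hT : T.IsBTree B) :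
    T.cone ∈ maxCones (nestohedron B y) := by
  have : ∀ I, ∃ m, I ∈ B → m ∈ I ∧ ∀ i ∈ I, T.Le i m := fun I => by
    by_cases hI : I ∈ B
    · obtain ⟨m, hm⟩ := hT.exists_top hB hI
      exact ⟨m, fun _ => hm⟩
    · exact ⟨T.root, fun h => absurd h hI⟩
  choose m hm using this
  refine ⟨⟨_, isFace_vertex hy (l := fun i => -(T.dp i : ℝ)) (m := m) (fun I hI => (hm I hI).1)
    fun I hI i hi him => ?_, ?_⟩, T.isFullDim_cone⟩
  · simpa using ((hm I hI).2 i hi).dp_lt him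
  · rw [normalCone_vertex hy fun I hI => (hm I hI).1, cone_eq hT.descendants_mem hm]

/-! ### Construction of trees -/

/-- A function `par` that raises `x` at all points other than its fixed point `r` is the parent
function of a tree with root `r`. -/
theorem exists_of_parent (par : Fin n → Fin n) (r : Fin n) (x : Fin n → ℝ) (hr : par r = r)
    (hx : ∀ i, i ≠ r → x i < x (par i)) :
    ∃ T : LabelledTree n, T.root = r ∧ ∀ i j, T.Edge i j ↔ i ≠ r ∧ par i = j := by
  classical
  let G : SimpleGraph (Fin n) := SimpleGraph.fromRel fun i j => par i = j
  have hwf : WellFounded fun a b : Fin n => x b < x a :=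
    have : IsTrans (Fin n) fun a b => x b < x a := ⟨fun _ _ _ h₁ h₂ => h₂.trans h₁⟩
    have : Std.Irrefl fun a b : Fin n => x b < x a := ⟨fun _ => lt_irrefl _⟩
    Finite.wellFounded_of_trans_of_irrefl _
  have hadj : ∀ i, i ≠ r → G.Adj i (par i) := fun i hi => by
    rw [SimpleGraph.fromRel_adj]
    refine ⟨fun h => ?_, .inl rfl⟩
    have := hx i hi
    rw [← h] at this
    exact lt_irrefl _ this
  have hreach : ∀ i, G.Reachable i r := fun i => by
    induction i using hwf.induction with
    | _ i ih =>
      by_cases hi : i = r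
      · rw [hi]
      · exact (hadj i hi).reachable.trans (ih _ (hx i hi))
  have hconn : G.Connected :=
    have : Nonempty (Fin n) := ⟨r⟩
    ⟨fun i j => (hreach i).trans (hreach j).symm⟩
  -- One edge for each non-root node: at most `n - 1` edges, so the connected graph is a tree.
  have hedges : G.edgeSet ⊆ ((Finset.univ.erase r).image fun i => s(i, par i) : Finset _) := by
    intro e he
    induction e using Sym2.ind with
    | _ i j =>
      rw [SimpleGraph.mem_edgeSet, SimpleGraph.fromRel_adj] at he
      obtain ⟨hne, rfl | rfl⟩ := he
      · simp only [Finset.coe_image, Set.mem_image]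
        refine ⟨i, ?_, rfl⟩
        simp only [Finset.coe_erase, Finset.coe_univ, Set.mem_sdiff, Set.mem_univ, true_and,
          Set.mem_singleton_iff]
        rintro rfl
        exact hne hr.symm
      · simp only [Finset.coe_image, Set.mem_image]
        refine ⟨j, ?_, Sym2.eq_swap⟩
        simp only [Finset.coe_erase, Finset.coe_univ, Set.mem_sdiff, Set.mem_univ, true_and,
          Set.mem_singleton_iff]
        rintro rfl
        exact hne hr
  have htree : G.IsTree := by
    rw [SimpleGraph.isTree_iff_connected_and_card]
    refine ⟨hconn, le_antisymm ?_ hconn.card_vert_le_card_edgeSet_add_one⟩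
    have h₁ := Set.ncard_le_ncard hedges (Finset.finite_toSet _)
    rw [Set.ncard_coe_finset] at h₁
    have h₂ := (h₁.trans Finset.card_image_le)
    rw [Finset.card_erase_of_mem (Finset.mem_univ r), Finset.card_univ] at h₂
    have h₃ : 0 < Fintype.card (Fin n) := Fintype.card_pos_iff.2 ⟨r⟩
    rw [Nat.card_coe_set_eq, Nat.card_eq_fintype_card]
    omega
  let T : LabelledTree n := ⟨G, r, htree⟩
  -- Induction from large `x` downwards. If the edge pointed from `par i` to `i`, uniqueness of
  -- parents would give `par (par i) = i`, although `par` raises `x`.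
  have hedge : ∀ i, i ≠ r → T.Edge i (par i) := fun i => by
    induction i using hwf.induction with
    | _ i ih =>
      intro hi
      refine (adj_iff (T := T).1 (hadj i hi)).resolve_right fun h => ?_
      have hp : par i ≠ r := fun hp => not_edge_root (T := T) i (by rwa [hp] at h)
      have := (ih _ (hx i hi) hp).unique h
      have h₁ := hx _ hp
      rw [this] at h₁
      exact lt_asymm h₁ (hx i hi)
  refine ⟨T, rfl, fun i j => ⟨fun h => ?_, ?_⟩⟩
  · have hi : i ≠ r := by
      rintro rfl
      exact not_edge_root (T := T) j h
    exact ⟨hi, (hedge i hi).unique h⟩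
  · rintro ⟨hi, rfl⟩
    exact hedge i hi

end LabelledTree

/-! ### From functionals with distinct coordinates to `B`-trees -/

open Classical in
/-- The largest element of `B` in which `x` is maximal at `j`. -/
noncomputable def maxBlock (B : Finset (Finset (Fin n))) (x : Fin n → ℝ) (j : Fin n) :
    Finset (Fin n) :=
  (B.filter fun I => j ∈ I ∧ ∀ i ∈ I, x i ≤ x j).biUnion id

section maxBlock

variable {B : Finset (Finset (Fin n))} {x : Fin n → ℝ}

theorem subset_maxBlock {I : Finset (Fin n)} (hI : I ∈ B) {j : Fin n} (hj : j ∈ I)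
    (h : ∀ i ∈ I, x i ≤ x j) : I ⊆ maxBlock B x j := fun _ hi =>
  Finset.mem_biUnion.2 ⟨I, Finset.mem_filter.2 ⟨hI, hj, h⟩, hi⟩

theorem le_of_mem_maxBlock {i j : Fin n} (h : i ∈ maxBlock B x j) : x i ≤ x j := by
  obtain ⟨I, hI, hi⟩ := Finset.mem_biUnion.1 h
  exact (Finset.mem_filter.1 hI).2.2 i hi

variable (hB : IsBuildingSet B)
include hB

theorem mem_maxBlock_self (j : Fin n) : j ∈ maxBlock B x j :=
  subset_maxBlock (hB.singleton_mem j) (Finset.mem_singleton_self j) (by simp)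
    (Finset.mem_singleton_self j)

open Classical in
theorem maxBlock_mem (j : Fin n) : maxBlock B x j ∈ B := by
  have := hB.union_biUnion_mem (hB.singleton_mem j)
    (B.filter fun I => j ∈ I ∧ ∀ i ∈ I, x i ≤ x j) (f := id) fun I hI => by
      rw [Finset.mem_filter] at hI
      exact ⟨hI.1, j, Finset.mem_inter.2 ⟨hI.2.1, Finset.mem_singleton_self j⟩⟩
  rw [Finset.union_eq_right.2] at this
  · rw [maxBlock]
    convert this
  · have h := mem_maxBlock_self (x := x) hB j
    rw [Finset.singleton_subset_iff]
    rw [maxBlock] at h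
    convert h

/-- The two blocks meet, so their union is in `B`; `x` is maximal on it at `k`, hence the block of
`k` absorbs it. -/
theorem maxBlock_subset {i j k : Fin n} (hik : i ∈ maxBlock B x j) (hi : i ∈ maxBlock B x k)
    (hjk : x j ≤ x k) : maxBlock B x j ⊆ maxBlock B x k := by
  refine Finset.subset_union_left.trans (subset_maxBlock (hB.union_mem _ (maxBlock_mem hB j) _
    (maxBlock_mem hB k) ⟨i, Finset.mem_inter.2 ⟨hik, hi⟩⟩)
    (Finset.mem_union_right _ (mem_maxBlock_self hB k)) fun l hl => ?_)
  rcases Finset.mem_union.1 hl with h | h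
  · exact (le_of_mem_maxBlock h).trans hjk
  · exact le_of_mem_maxBlock h

end maxBlock

/-- The tree in which the descendants of `j` form the largest element of `B` in which `x` is
maximal at `j`. -/
theorem exists_tree_le_iff {B : Finset (Finset (Fin n))} (hB : IsConnectedBuildingSet B)
    {x : Fin n → ℝ} (hx : Function.Injective x) :
    ∃ T : LabelledTree n, ∀ i j, T.Le i j ↔ i ∈ maxBlock B x j := by
  classical
  obtain ⟨r, -, hr⟩ := Finset.exists_max_image Finset.univ x (hB.1.nonempty _ hB.2)
  have hroot : ∀ i, i ∈ maxBlock B x r := fun i =>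
    subset_maxBlock hB.2 (Finset.mem_univ r) hr (Finset.mem_univ i)
  -- The parent of `i` is the node other than `i`, with least `x`, whose block contains `i`.
  have hpar : ∀ i, ∃ p, (i = r → p = r) ∧ (i ≠ r → x i < x p ∧ i ∈ maxBlock B x p ∧
      ∀ k, k ≠ i → i ∈ maxBlock B x k → x p ≤ x k) := fun i => by
    by_cases hi : i = r
    · exact ⟨r, fun _ => rfl, fun h => absurd hi h⟩
    · obtain ⟨p, hp, hmin⟩ := Finset.exists_min_image
        (Finset.univ.filter fun k => k ≠ i ∧ i ∈ maxBlock B x k) x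
        ⟨r, Finset.mem_filter.2 ⟨Finset.mem_univ r, Ne.symm hi, hroot i⟩⟩
      rw [Finset.mem_filter] at hp
      exact ⟨p, fun h => absurd h hi, fun _ =>
        ⟨(le_of_mem_maxBlock hp.2.2).lt_of_ne fun h => hp.2.1 (hx h).symm, hp.2.2,
          fun k hk hik => hmin k (Finset.mem_filter.2 ⟨Finset.mem_univ k, hk, hik⟩)⟩⟩
  choose par hpr hp using hpar
  obtain ⟨T, -, hT⟩ := LabelledTree.exists_of_parent par r x (hpr r rfl) fun i hi => (hp i hi).1
  refine ⟨T, fun i j => ⟨fun h => ?_, ?_⟩⟩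
  · induction h using Relation.ReflTransGen.head_induction_on with
    | refl => exact mem_maxBlock_self hB.1 j
    | head hab _ ih =>
      obtain ⟨ha, rfl⟩ := (hT _ _).1 hab
      exact maxBlock_subset hB.1 (mem_maxBlock_self hB.1 _) ih (le_of_mem_maxBlock ih)
        (hp _ ha).2.1
  · have hwf : WellFounded fun a b : Fin n => x b < x a :=
      have : IsTrans (Fin n) fun a b => x b < x a := ⟨fun _ _ _ h₁ h₂ => h₂.trans h₁⟩
      have : Std.Irrefl fun a b : Fin n => x b < x a := ⟨fun _ => lt_irrefl _⟩
      Finite.wellFounded_of_trans_of_irrefl _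
    induction i using hwf.induction with
    | _ i ih =>
      intro hij
      by_cases hne : i = j
      · exact hne ▸ LabelledTree.Le.refl _
      · have hi : i ≠ r := by
          rintro rfl
          exact hne (hx (le_antisymm (le_of_mem_maxBlock hij) (hr j (Finset.mem_univ j))))
        -- The blocks of `par i` and `j` share `i`, and `x (par i) ≤ x j` by minimality, so `par i`
        -- lies in the block of `j` and the climb continues.
        obtain ⟨h₁, h₂, h₃⟩ := hp i hi
        exact ((hT _ _).2 ⟨hi, rfl⟩).le.trans (ih _ h₁
          (maxBlock_subset hB.1 h₂ hij (h₃ j (Ne.symm hne) hij) (mem_maxBlock_self hB.1 _)))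

/-- If the union over `S` were in `B`, `x` would be maximal on it at some `j`, necessarily in `S`.
The union then lies in the block of `j`, which puts all of `S` below `j`. -/
theorem LabelledTree.isBTree_of_le_iff {B : Finset (Finset (Fin n))} (hB : IsBuildingSet B)
    {x : Fin n → ℝ} (hx : Function.Injective x) {T : LabelledTree n}
    (hT : ∀ i j, T.Le i j ↔ i ∈ maxBlock B x j) : T.IsBTree B := by
  have hdesc : ∀ i, T.descendants i = maxBlock B x i := fun i => by
    ext j
    rw [mem_descendants, hT]
  refine ⟨fun i => hdesc i ▸ maxBlock_mem hB i, fun S hS hinc hmem => ?_⟩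
  obtain ⟨j, hj, hmax⟩ := Finset.exists_max_image _ x (hB.nonempty _ hmem)
  obtain ⟨s, hs, hjs⟩ := Finset.mem_biUnion.1 hj
  have hself : ∀ t ∈ S, t ∈ S.biUnion T.descendants := fun t ht =>
    Finset.mem_biUnion.2 ⟨t, ht, mem_descendants.2 (Le.refl t)⟩
  rw [hdesc] at hjs
  obtain rfl : j = s := hx (le_antisymm (le_of_mem_maxBlock hjs) (hmax s (hself s hs)))
  obtain ⟨t, ht, htj⟩ := Finset.exists_mem_ne hS j
  exact hinc t ht j hs htj ((hT _ _).2 (subset_maxBlock hmem hj hmax (hself t ht)))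

theorem exists_cone_eq {B : Finset (Finset (Fin n))} (hB : IsConnectedBuildingSet B)
    {y : Finset (Fin n) → ℝ} (hy : ∀ I ∈ B, 0 < y I) {σ : Set (Fin n → ℝ)}
    (hσ : σ ∈ maxCones (nestohedron B y)) : ∃ T : LabelledTree n, T.IsBTree B ∧ T.cone = σ := by
  have : Nonempty (Fin n) := ⟨(hB.1.nonempty _ hB.2).choose⟩
  obtain ⟨x, m, hx, hm, rfl⟩ := maxCones_eq hy hB.1.nonempty hσ
  obtain ⟨T, hT⟩ := exists_tree_le_iff hB hx
  have hBT := LabelledTree.isBTree_of_le_iff hB.1 hx hT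
  exact ⟨T, hBT, LabelledTree.cone_eq hBT.descendants_mem fun I hI => ⟨(hm I hI).1, fun i hi =>
    (hT _ _).2 (subset_maxBlock hI (hm I hI).1 (hm I hI).2 hi)⟩⟩

end QH

open Classical in
/-- The first two parts say that the defining sum of the `q`-`h`-polynomial of the nestohedron is
finite and that the minimal rank functions in it exist and are unique. -/
theorem mainTheorem1 {n : ℕ} (B : Finset (Finset (Fin n)))
    (hB : QH.IsConnectedBuildingSet B)
    (y : Finset (Fin n) → ℝ) (hy : ∀ I ∈ B, 0 < y I) :
    (QH.maxCones (QH.nestohedron B y)).Finite ∧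
    (∀ σ : QH.maxCones (QH.nestohedron B y),
      ∃! ρ : Fin n → ℕ, QH.IsMinimalRankFunction (QH.conePoset σ.1 σ.2.2) ρ) ∧
    QH.qhPolynomial (QH.nestohedron B y) =
      ∑ T : QH.LabelledTree n with T.IsBTree B,
        MvPolynomial.X 0 ^ T.des * MvPolynomial.X 1 ^ T.maj := by
  let e : {T : QH.LabelledTree n // T.IsBTree B} → QH.maxCones (QH.nestohedron B y) :=
    fun T => ⟨T.1.cone, T.2.cone_mem hB.1 hy⟩
  have he : Function.Bijective e := by
    refine ⟨fun T T' h => ?_, fun σ => ?_⟩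
    · exact Subtype.ext (QH.LabelledTree.cone_injective (congrArg Subtype.val h))
    · obtain ⟨T, hT, h⟩ := QH.exists_cone_eq hB hy σ.2
      exact ⟨⟨T, hT⟩, Subtype.ext h⟩
  have hle : ∀ T : {T : QH.LabelledTree n // T.IsBTree B}, ∀ i j,
      (QH.conePoset (e T).1 (e T).2.2).le i j ↔ T.1.Le i j := fun T i j =>
    QH.LabelledTree.forall_mem_cone_le_iff
  refine ⟨Set.finite_coe_iff.1 (Finite.of_surjective e he.2), fun σ => ?_, ?_⟩
  · obtain ⟨T, rfl⟩ := he.2 σ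
    exact QH.LabelledTree.existsUnique_isMinimalRankFunction (hle T)
  · rw [QH.qhPolynomial, Finset.sum_subtype (p := fun T : QH.LabelledTree n => T.IsBTree B) _
      (fun T => Finset.mem_filter_univ T), ← finsum_eq_sum_of_fintype]
    refine (finsum_eq_of_bijective e he fun T => ?_).symm
    rw [QH.LabelledTree.posetDes_eq (hle T), QH.LabelledTree.posetMaj_eq (hle T)]
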